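/- Let $1\le d\le n$ and $1\le k\le n$ be integers, let $\lambda>0$, and let $a_1,\dots,a_n\in\mathbb R^d$. Put $\tilde k=\min\{k,d\}$ and $P=\{x\in[0,1]^n:\sum_{i=1}^n x_i=k\}$. Let $A\in\mathbb R^{d\times n}$ be the matrix with columns $a_i$, let $C=A^\top A+\lambda I_n$, and let $H\in\mathbb R^{n\times n}$, with columns $h_1,\dots,h_n$, satisfy $C=H^\top H$ (for instance a Cholesky factor of $C$). For a positive semidefinite $X\in\mathbb R^{d\times d}$ with eigenvalues $\sigma_1\ge\cdots\ge\sigma_d\ge0$ let $\Gamma(X;\lambda)=\sum_{i=1}^{\tilde k}\frac1{\sigma_i+\lambda}$, and let $\operatorname{conv}\Gamma(\cdot;\lambda)$ be its convex envelope, i.e. the pointwise largest convex function on the cone of positive semidefinite $d\times d$ matrices that is bounded above by $\Gamma(\cdot;\lambda)$. For a positive semidefinite $Y\in\mathbb R^{n\times n}$ of rank at least $k$ with eigenvalues $\beta_1\ge\cdots\ge\beta_n\ge0$ let $$\Phi(Y)=\sum_{i=1}^{\iota}\frac1{\beta_i}+\frac{(k-\iota)^2}{\sum_{i=\iota+1}^n\beta_i},$$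 where $\iota$ is the unique integer with $0\le\iota\le k-1$ and $\beta_\iota>\frac1{k-\iota}\sum_{i=\iota+1}^n\beta_i\ge\beta_{\iota+1}$, with the convention $\beta_0=\infty$. Define $$\nu^C_k=\min_{x\in P}\operatorname{tr}\Big(\Big(\sum_{i=1}^n x_ia_ia_i^\top+\lambda I_d\Big)^{-1}\Big),$$ $$\nu^N_k=\min_{x\in P}\Big\{\operatorname{conv}\Gamma\Big(\sum_{i=1}^n x_ia_ia_i^\top;\lambda\Big)+\frac{d-\tilde k}{\lambda}\Big\},$$ $$\nu^M_k=\min_{x\in P}\Big\{\Phi\Big(\sum_{i=1}^n x_ih_ih_i^\top\Big)+\frac{d-k}{\lambda}\Big\}.$$ Then these minima are attained, and (i) $\nu^N_k=\nu^C_k$ if $d\le k\le n$; (ii) $\nu^N_k\ge\nu^C_k$ if $1\le k\le d-1$; (iii) $\nu^N_k\ge\nu^M_k$ for every $1\le k\le n$. -/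

import Mathlib

namespace RAOD

/-- The eigenvalues of a real symmetric `m × m` matrix, listed with multiplicity in nonincreasing
order and indexed from `0`: `eig X 0 ≥ eig X 1 ≥ ⋯ ≥ eig X (m - 1)`.
The value is `0` for an index `≥ m` or a matrix that is not symmetric. -/
noncomputable def eig {m : ℕ} (X : Matrix (Fin m) (Fin m) ℝ) (i : ℕ) : ℝ :=
  open Classical in
  if h : X.IsHermitian ∧ i < m then
    h.1.eigenvalues₀ ⟨i, h.2.trans_eq (Fintype.card_fin m).symm⟩
  else 0

/-- The cone of positive semidefinite real symmetric `m × m` matrices. -/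
def psdCone (m : ℕ) : Set (Matrix (Fin m) (Fin m) ℝ) := {X | X.PosSemidef}

/-- The convex envelope of `f` on `s`, i.e. the pointwise supremum of all functions that are
convex on `s` and bounded above by `f` on `s`. -/
noncomputable def convEnvelope {E : Type*} [AddCommGroup E] [Module ℝ E]
    (s : Set E) (f : E → ℝ) (x : E) : ℝ :=
  sSup {y : ℝ | ∃ g : E → ℝ, ConvexOn ℝ s g ∧ (∀ z ∈ s, g z ≤ f z) ∧ y = g x}

/-- `Γ(X; λ) = ∑_{i ≤ min(k, d)} 1 / (σ_i + λ)`, with `σ_1 ≥ ⋯ ≥ σ_d` the eigenvalues of `X`. -/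
noncomputable def Gam {d : ℕ} (k : ℕ) (lam : ℝ) (X : Matrix (Fin d) (Fin d) ℝ) : ℝ :=
  ∑ i ∈ Finset.range (min k d), 1 / (eig X i + lam)

/-- The convex envelope of `Γ(·; λ)` on the positive semidefinite cone. -/
noncomputable def convGam {d : ℕ} (k : ℕ) (lam : ℝ) (X : Matrix (Fin d) (Fin d) ℝ) : ℝ :=
  convEnvelope (psdCone d) (Gam k lam) X

/-- For `β_1 ≥ ⋯ ≥ β_n` (here `β_j` is `β (j - 1)`), the property
`β_ι > (1 / (k - ι)) ∑_{i = ι + 1}^n β_i ≥ β_{ι + 1}` of an integer `0 ≤ ι ≤ k - 1`,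
where `β_0 = ∞`. -/
def IsIota (n k : ℕ) (β : ℕ → ℝ) (ι : ℕ) : Prop :=
  ι < k ∧
  (ι = 0 ∨ (1 / ((k : ℝ) - ι)) * ∑ i ∈ Finset.Ico ι n, β i < β (ι - 1)) ∧
  β ι ≤ (1 / ((k : ℝ) - ι)) * ∑ i ∈ Finset.Ico ι n, β i

/-- The integer of `IsIota`. -/
noncomputable def iota (n k : ℕ) (β : ℕ → ℝ) : ℕ := sInf {ι | IsIota n k β ι}

/-- There is exactly one integer as in `IsIota` if the `β_i` are nonnegative and nonincreasing. -/
theorem existsUnique_isIota {n k : ℕ} (hk : 1 ≤ k) (hkn : k ≤ n) (β : ℕ → ℝ)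
    (hβ : ∀ i j, i ≤ j → j < n → β j ≤ β i) (h0 : ∀ i, 0 ≤ β i) :
    ∃! ι, IsIota n k β ι := by
  classical
  -- the two inequalities with the denominator cleared
  have key : ∀ ι, IsIota n k β ι ↔ ι < k ∧
      (ι = 0 ∨ ∑ i ∈ Finset.Ico ι n, β i < ((k : ℝ) - ι) * β (ι - 1)) ∧
      ((k : ℝ) - ι) * β ι ≤ ∑ i ∈ Finset.Ico ι n, β i := by
    intro ι
    unfold IsIota
    refine and_congr_right fun h => ?_
    have hp : (0 : ℝ) < (k : ℝ) - ι := by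
      have : (ι : ℝ) < k := by exact_mod_cast h
      linarith
    rw [one_div_mul_eq_div, div_lt_iff₀ hp, le_div_iff₀ hp, mul_comm (β (ι - 1)), mul_comm (β ι)]
  have hS : ∀ ι, ι < n →
      ∑ i ∈ Finset.Ico ι n, β i = β ι + ∑ i ∈ Finset.Ico (ι + 1) n, β i :=
    fun ι h => Finset.sum_eq_sum_Ico_succ_bot h β
  -- `P ι` is the second inequality
  let P : ℕ → Prop := fun ι => ((k : ℝ) - ι) * β ι ≤ ∑ i ∈ Finset.Ico ι n, β i
  have hex : ∃ ι, P ι := by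
    refine ⟨k - 1, ?_⟩
    have h1 : ((k : ℝ) - ((k - 1 : ℕ) : ℝ)) = 1 := by
      rw [Nat.cast_sub hk]; simp
    show _ ≤ _
    rw [h1, one_mul, hS (k - 1) (by omega)]
    have := Finset.sum_nonneg (s := Finset.Ico (k - 1 + 1) n) (f := β) fun i _ => h0 i
    linarith
  have hstep : ∀ j, j + 1 < n → P j → P (j + 1) := by
    intro j hj h
    have hb := hβ j (j + 1) (by omega) hj
    have h' : ((k : ℝ) - j) * β j ≤ ∑ i ∈ Finset.Ico j n, β i := h
    rw [hS j (by omega)] at h'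
    show ((k : ℝ) - ((j + 1 : ℕ) : ℝ)) * β (j + 1) ≤ _
    push_cast
    have hs := Finset.sum_nonneg (s := Finset.Ico (j + 1) n) (f := β) fun i _ => h0 i
    rcases le_or_gt 0 ((k : ℝ) - (j + 1)) with hc | hc
    · nlinarith [mul_le_mul_of_nonneg_left hb hc]
    · nlinarith [mul_nonneg_of_nonpos_of_nonpos hc.le (neg_nonpos.2 (h0 (j + 1)))]
  have hlt : Nat.find hex < k := by
    have : Nat.find hex ≤ k - 1 := by
      refine Nat.find_min' hex ?_
      show ((k : ℝ) - ((k - 1 : ℕ) : ℝ)) * _ ≤ _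
      have h1 : ((k : ℝ) - ((k - 1 : ℕ) : ℝ)) = 1 := by
        rw [Nat.cast_sub hk]; simp
      rw [h1, one_mul, hS (k - 1) (by omega)]
      have := Finset.sum_nonneg (s := Finset.Ico (k - 1 + 1) n) (f := β) fun i _ => h0 i
      linarith
    omega
  -- the first inequality at `j + 1` is the failure of `P` at `j`
  have hfirst : ∀ j, j < n →
      (∑ i ∈ Finset.Ico (j + 1) n, β i < ((k : ℝ) - ((j + 1 : ℕ) : ℝ)) * β j ↔ ¬ P j) := by
    intro j hj
    show _ ↔ ¬ (((k : ℝ) - j) * β j ≤ ∑ i ∈ Finset.Ico j n, β i)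
    rw [not_le, hS j hj]
    push_cast
    constructor <;> intro h <;> nlinarith
  refine ⟨Nat.find hex, (key _).2 ⟨hlt, ?_, Nat.find_spec hex⟩, ?_⟩
  · rcases h : Nat.find hex with _ | j
    · exact Or.inl rfl
    · right
      exact (hfirst j (by omega)).2 (Nat.find_min hex (by omega))
  · intro ι hι
    obtain ⟨h1, h2, h3⟩ := (key ι).1 hι
    refine le_antisymm ?_ (Nat.find_min' hex h3)
    rcases ι with _ | j
    · exact Nat.zero_le _
    · rcases h2 with h2 | h2
      · omega
      · have hnp := (hfirst j (by omega)).1 h2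
        by_contra hcon
        have hle : Nat.find hex ≤ j := by omega
        refine hnp (Nat.le_induction (P := fun i _ => i < n → P i)
          (fun _ => Nat.find_spec hex) ?_ j hle (by omega))
        intro i _ ih hi
        exact hstep i hi (ih (by omega))

/-- `φ(β) = ∑_{i ≤ ι} 1 / β_i + (k - ι)² / ∑_{i = ι + 1}^n β_i`. -/
noncomputable def phi (n k : ℕ) (β : ℕ → ℝ) : ℝ :=
  ∑ i ∈ Finset.range (iota n k β), 1 / β i +
    ((k : ℝ) - iota n k β) ^ 2 / ∑ i ∈ Finset.Ico (iota n k β) n, β i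

/-- `Φ(Y) = φ(β)`, with `β_1 ≥ ⋯ ≥ β_n` the eigenvalues of `Y`. -/
noncomputable def Phi {n : ℕ} (k : ℕ) (Y : Matrix (Fin n) (Fin n) ℝ) : ℝ :=
  phi n k (eig Y)

/-- `∑_i x_i v_i v_iᵀ`. -/
def wsum {n m : ℕ} (v : Fin n → Fin m → ℝ) (x : Fin n → ℝ) : Matrix (Fin m) (Fin m) ℝ :=
  ∑ i, x i • Matrix.vecMulVec (v i) (v i)

/-- The feasible set `{x ∈ [0,1]^n : ∑_i x_i = k}`. -/
def feasible (n k : ℕ) : Set (Fin n → ℝ) :=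
  {x | (∀ i, 0 ≤ x i ∧ x i ≤ 1) ∧ ∑ i, x i = (k : ℝ)}

/-- The `d × n` matrix with columns `a_1, …, a_n`. -/
def colMatrix {d n : ℕ} (a : Fin n → Fin d → ℝ) : Matrix (Fin d) (Fin n) ℝ :=
  Matrix.of fun r i => a i r

/-- `C = Aᵀ A + λ I_n`, with `A` the matrix with columns `a_1, …, a_n`. -/
def covMatrix {d n : ℕ} (a : Fin n → Fin d → ℝ) (lam : ℝ) : Matrix (Fin n) (Fin n) ℝ :=
  (colMatrix a).transpose * colMatrix a + lam • (1 : Matrix (Fin n) (Fin n) ℝ)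

/-- Objective of the conventional relaxation: `tr((∑_i x_i a_i a_iᵀ + λ I_d)⁻¹)`. -/
noncomputable def objC {d n : ℕ} (a : Fin n → Fin d → ℝ) (lam : ℝ) (x : Fin n → ℝ) : ℝ :=
  ((wsum a x + lam • (1 : Matrix (Fin d) (Fin d) ℝ))⁻¹).trace

/-- Objective of the new relaxation: `conv Γ(∑_i x_i a_i a_iᵀ; λ) + (d - min(k, d)) / λ`. -/
noncomputable def objN {d n : ℕ} (a : Fin n → Fin d → ℝ) (lam : ℝ) (k : ℕ)
    (x : Fin n → ℝ) : ℝ :=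
  convGam k lam (wsum a x) + ((d : ℝ) - (min k d : ℕ)) / lam

/-- Objective of the relaxation through the factor `H` of `C = Hᵀ H`, whose columns are
`h_1, …, h_n`: `Φ(∑_i x_i h_i h_iᵀ) + (d - k) / λ`. -/
noncomputable def objM {n : ℕ} (d : ℕ) (H : Matrix (Fin n) (Fin n) ℝ) (lam : ℝ) (k : ℕ)
    (x : Fin n → ℝ) : ℝ :=
  Phi k (wsum (fun i j => H j i) x) + ((d : ℝ) - k) / lam

/-- The value `ν^C_k` of the conventional relaxation. -/
noncomputable def nuC {d n : ℕ} (a : Fin n → Fin d → ℝ) (lam : ℝ) (k : ℕ) : ℝ :=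
  sInf (objC a lam '' feasible n k)

/-- The value `ν^N_k` of the new relaxation. -/
noncomputable def nuN {d n : ℕ} (a : Fin n → Fin d → ℝ) (lam : ℝ) (k : ℕ) : ℝ :=
  sInf (objN a lam k '' feasible n k)

/-- The value `ν^M_k` of the relaxation through the factor `H`. -/
noncomputable def nuM {n : ℕ} (d : ℕ) (H : Matrix (Fin n) (Fin n) ℝ) (lam : ℝ) (k : ℕ) : ℝ :=
  sInf (objM d H lam k '' feasible n k)

end RAOD

/-!
All three objectives are instances of one function of the eigenvalues `β_1 ≥ ⋯ ≥ β_m ≥ 0` of a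
matrix. Level the smallest `m - ι` eigenvalues to get a sequence `μ` of length `k` with the same
sum, and put `f(β) = ∑_{i ≤ k} 1 / (μ_i + λ)`. With `λ = 0` this is `φ`, with `k = m` it is the
trace of the regularized inverse, and with `k` replaced by `min(k, d)` it is `conv Γ`.

The tangents of `t ↦ 1 / t` at the `μ_i + λ` have slopes that are constant on the levelled part, so
they add up to a linear function of `β` with weights `-w`, where `w` is nondecreasing. Together with
the trace inequality `∑ w_i β_i(Y) ≤ tr(Q diag(w) Qᵀ Y)` this gives a subgradient of `X ↦ f(β(X))`
at every point, hence convexity and attained minima. Conversely `β_i = μ_i p_i` with `p` in the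
hypersimplex; writing `p` as a convex combination of vertices writes `X` as a convex combination of
matrices for which the values of `Γ` average to at most `f(β)`.

The inequalities between the values hold pointwise in `x`. By the same tangents, `f` decreases if
`∑ w_i β_i` increases for every nondecreasing `w`, and `Hᵀ H = Aᵀ A + λ I` shows that the
eigenvalues of `∑ x_i h_i h_iᵀ` dominate those of `∑ x_i a_i a_iᵀ`, shifted by `λ` in the first
`k` places, in this sense.
-/

namespace RAOD

open Finset Matrix

section Subgradients

variable {E F : Type*} [AddCommGroup E] [Module ℝ E] [AddCommGroup F] [Module ℝ F]
  {s : Set E} {f : E → ℝ}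

/-- `f` has a subgradient relative to `s` at every point of `s`. This yields convexity and
attained minima together; the subgradient is a bare linear functional so that no topology is
needed on spaces of matrices. -/
def HasSubgradientsOn (s : Set E) (f : E → ℝ) : Prop :=
  ∀ z ∈ s, ∃ L : E →ₗ[ℝ] ℝ, ∀ y ∈ s, f z + L (y - z) ≤ f y

namespace HasSubgradientsOn

theorem congr {g : E → ℝ} (hf : HasSubgradientsOn s f) (h : Set.EqOn g f s) :
    HasSubgradientsOn s g := by
  intro z hz
  obtain ⟨L, hL⟩ := hf z hz
  exact ⟨L, fun y hy => by simpa only [h hz, h hy] using hL y hy⟩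

theorem add_const (hf : HasSubgradientsOn s f) (c : ℝ) :
    HasSubgradientsOn s fun x => f x + c := by
  intro z hz
  obtain ⟨L, hL⟩ := hf z hz
  exact ⟨L, fun y hy => by linarith [hL y hy]⟩

theorem comp_linearMap (hf : HasSubgradientsOn s f) (A : F →ₗ[ℝ] E) {t : Set F}
    (hA : Set.MapsTo A t s) : HasSubgradientsOn t (f ∘ A) := by
  intro z hz
  obtain ⟨L, hL⟩ := hf (A z) (hA hz)
  exact ⟨L ∘ₗ A, fun y hy => by simpa using hL (A y) (hA hy)⟩

theorem convexOn (hf : HasSubgradientsOn s f) (hs : Convex ℝ s) : ConvexOn ℝ s f := by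
  refine ⟨hs, fun x hx y hy a b ha hb hab => ?_⟩
  obtain ⟨L, hL⟩ := hf _ (hs hx hy ha hb hab)
  set z := a • x + b • y
  have hz : a * L (x - z) + b * L (y - z) = 0 := by
    have hcomb : a • (x - z) + b • (y - z) = 0 := by
      rw [smul_sub, smul_sub, sub_add_sub_comm, ← add_smul, hab, one_smul, sub_self]
    simpa using congrArg L hcomb
  calc f z = a * (f z + L (x - z)) + b * (f z + L (y - z)) := by
        linear_combination -hz - f z * hab
    _ ≤ a • f x + b • f y :=
        add_le_add (mul_le_mul_of_nonneg_left (hL x hx) ha)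
          (mul_le_mul_of_nonneg_left (hL y hy) hb)

variable [TopologicalSpace E] [IsTopologicalAddGroup E] [ContinuousSMul ℝ E] [T2Space E]
  [FiniteDimensional ℝ E]

theorem lowerSemicontinuousOn (hf : HasSubgradientsOn s f) : LowerSemicontinuousOn f s := by
  intro z hz c hc
  obtain ⟨L, hL⟩ := hf z hz
  have hcont : Continuous fun y => f z + L (y - z) :=
    continuous_const.add
      (L.continuous_of_finiteDimensional.comp (continuous_id.sub continuous_const))
  have hev : ∀ᶠ y in nhds z, c < f z + L (y - z) :=
    hcont.continuousAt.eventually_const_lt (by simpa using hc)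
  filter_upwards [nhdsWithin_le_nhds hev, self_mem_nhdsWithin] with y hy hys
  exact hy.trans_le (hL y hys)

theorem isLeast_sInf_image (hf : HasSubgradientsOn s f) (hs : IsCompact s) (hne : s.Nonempty) :
    IsLeast (f '' s) (sInf (f '' s)) := by
  obtain ⟨x, hx, hmin⟩ := hf.lowerSemicontinuousOn.exists_isMinOn hne hs
  have hleast : IsLeast (f '' s) (f x) :=
    ⟨Set.mem_image_of_mem f hx, Set.forall_mem_image.2 fun _ hy => hmin hy⟩
  rwa [hleast.csInf_eq]

end HasSubgradientsOn

theorem le_of_isLeast_image {α : Type*} {s : Set α} {f g : α → ℝ} {a b : ℝ}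
    (hf : IsLeast (f '' s) a) (hg : IsLeast (g '' s) b) (h : ∀ x ∈ s, f x ≤ g x) : a ≤ b := by
  obtain ⟨x, hx, rfl⟩ := hg.1
  exact (hf.2 (Set.mem_image_of_mem f hx)).trans (h x hx)

end Subgradients

section DoublyStochastic

variable {ι : Type*} [Fintype ι] [DecidableEq ι] {M : Matrix ι ι ℝ}

theorem mulVec_mem_convexHull_range_comp_perm (hM : M ∈ doublyStochastic ℝ ι) (s : ι → ℝ) :
    M *ᵥ s ∈ convexHull ℝ (Set.range fun σ : Equiv.Perm ι => s ∘ σ) := by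
  obtain ⟨c, hc0, hc1, rfl⟩ := exists_eq_sum_perm_of_mem_doublyStochastic hM
  rw [sum_mulVec]
  simp only [smul_mulVec, permMatrix_mulVec]
  exact (convex_convexHull ℝ _).sum_mem (fun σ _ => hc0 σ) hc1
    fun σ _ => subset_convexHull ℝ _ (Set.mem_range_self σ)

theorem dotProduct_le_dotProduct_mulVec_of_antivary {w s : ι → ℝ} (h : Antivary w s)
    (hM : M ∈ doublyStochastic ℝ ι) : w ⬝ᵥ s ≤ w ⬝ᵥ M *ᵥ s := by
  have hlin : IsLinearMap ℝ (w ⬝ᵥ ·) := ⟨dotProduct_add w, fun c y => dotProduct_smul c w y⟩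
  refine convexHull_min ?_ (convex_halfSpace_ge hlin (w ⬝ᵥ s))
    (mulVec_mem_convexHull_range_comp_perm hM s)
  rintro _ ⟨σ, rfl⟩
  exact h.sum_smul_le_sum_smul_comp_perm

theorem sq_mem_doublyStochastic {R : Matrix ι ι ℝ} (hR : Rᵀ * R = 1) :
    (of fun i j => R i j ^ 2) ∈ doublyStochastic ℝ ι := by
  have hR' : R * Rᵀ = 1 := mul_eq_one_comm.1 hR
  rw [mem_doublyStochastic_iff_sum]
  refine ⟨fun i j => sq_nonneg _, fun i => ?_, fun j => ?_⟩
  · simpa [Matrix.mul_apply, sq] using congrFun (congrFun hR' i) i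
  · simpa [Matrix.mul_apply, sq] using congrFun (congrFun hR j) j

end DoublyStochastic

section Hypersimplex

variable {m r : ℕ} {p : Fin m → ℝ}

theorem isCompact_feasible (m r : ℕ) : IsCompact (feasible m r) := by
  have h : feasible m r = Set.Icc 0 1 ∩ {x | ∑ i, x i = (r : ℝ)} := by
    ext x
    simp only [feasible, Set.mem_ofPred_eq, Set.mem_inter_iff, Set.mem_Icc, Pi.le_def,
      Pi.zero_apply, Pi.one_apply, forall_and]
  rw [h]
  exact isCompact_Icc.inter_right
    (isClosed_eq (continuous_finsetSum _ fun i _ => continuous_apply i) continuous_const)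

/-- The vertex `(1, …, 1, 0, …, 0)`, with `r` ones, of the hypersimplex `feasible m r`. -/
def firstVertex (m r : ℕ) (i : Fin m) : ℝ := if (i : ℕ) < r then 1 else 0

theorem sum_fin_ite_lt (hr : r ≤ m) (a b : ℝ) :
    ∑ i : Fin m, (if (i : ℕ) < r then a else b) = r * a + (m - r) * b := by
  rw [Fin.sum_univ_eq_sum_range (fun i => if i < r then a else b), ← sum_range_add_sum_Ico _ hr,
    sum_congr rfl fun i hi => if_pos (mem_range.1 hi),
    sum_congr rfl fun i hi => if_neg (not_lt.2 (mem_Ico.1 hi).1)]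
  simp [Nat.cast_sub hr]

theorem firstVertex_mem_feasible (hr : r ≤ m) : firstVertex m r ∈ feasible m r := by
  refine ⟨fun i => ?_, (sum_fin_ite_lt hr 1 0).trans (by ring)⟩
  unfold firstVertex
  split_ifs <;> norm_num

/-- The matrix whose first `r` columns are `p / r` and whose other columns are
`(1 - p) / (m - r)`: a doubly stochastic matrix carrying `firstVertex m r` to `p`. A denominator
is `0` only for `r = 0` or `r = m`, where `p = 0` or `p = 1`. -/
noncomputable def hypersimplexMatrix (r : ℕ) (p : Fin m → ℝ) : Matrix (Fin m) (Fin m) ℝ :=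
  of fun j i => if (i : ℕ) < r then p j / r else (1 - p j) / (m - r)

theorem mul_div_cancel_of_mem_feasible (hp : p ∈ feasible m r) (j : Fin m) :
    r * (p j / r) = p j := by
  refine mul_div_cancel_of_imp' fun h => ?_
  exact (sum_eq_zero_iff_of_nonneg fun i _ => (hp.1 i).1).1 (hp.2.trans h) j (mem_univ j)

theorem mul_one_sub_div_cancel_of_mem_feasible (hp : p ∈ feasible m r) (j : Fin m) :
    (m - r) * ((1 - p j) / (m - r)) = 1 - p j := by
  refine mul_div_cancel_of_imp' fun h => ?_
  have hsum : ∑ i, (1 - p i) = 0 := by simpa [hp.2] using h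
  exact (sum_eq_zero_iff_of_nonneg fun i _ => sub_nonneg.2 (hp.1 i).2).1 hsum j (mem_univ j)

theorem hypersimplexMatrix_mulVec_firstVertex (hr : r ≤ m) (hp : p ∈ feasible m r) :
    hypersimplexMatrix r p *ᵥ firstVertex m r = p := by
  funext j
  calc (hypersimplexMatrix r p *ᵥ firstVertex m r) j
      = ∑ i : Fin m, if (i : ℕ) < r then p j / r else 0 := by
        rw [mulVec, dotProduct]
        refine sum_congr rfl fun i _ => ?_
        by_cases hi : (i : ℕ) < r <;> simp [hypersimplexMatrix, firstVertex, hi]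
    _ = p j := by
        rw [sum_fin_ite_lt hr, mul_div_cancel_of_mem_feasible hp, mul_zero, add_zero]

theorem hypersimplexMatrix_mem_doublyStochastic (hr : r ≤ m) (hp : p ∈ feasible m r) :
    hypersimplexMatrix r p ∈ doublyStochastic ℝ (Fin m) := by
  have hmr : (0 : ℝ) ≤ m - r := sub_nonneg.2 (Nat.cast_le.2 hr)
  rw [mem_doublyStochastic_iff_sum]
  refine ⟨fun j i => ?_, fun j => ?_, fun i => ?_⟩
  · rw [hypersimplexMatrix, of_apply]
    split_ifs
    · exact div_nonneg (hp.1 j).1 r.cast_nonneg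
    · exact div_nonneg (sub_nonneg.2 (hp.1 j).2) hmr
  · simp only [hypersimplexMatrix, of_apply, sum_fin_ite_lt hr,
      mul_div_cancel_of_mem_feasible hp, mul_one_sub_div_cancel_of_mem_feasible hp,
      add_sub_cancel]
  · by_cases hi : (i : ℕ) < r
    · have hr0 : (r : ℝ) ≠ 0 := Nat.cast_ne_zero.2 (Nat.ne_zero_of_lt hi)
      simp only [hypersimplexMatrix, of_apply, if_pos hi]
      rw [← sum_div, hp.2, div_self hr0]
    · have hmr0 : (m - r : ℝ) ≠ 0 :=
        sub_ne_zero.2 (Nat.cast_injective.ne ((not_lt.1 hi).trans_lt i.2).ne')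
      simp only [hypersimplexMatrix, of_apply, if_neg hi]
      rw [← sum_div, sum_sub_distrib, hp.2, sum_const, card_univ, Fintype.card_fin,
        nsmul_one, div_self hmr0]

theorem feasible_subset_convexHull (hr : r ≤ m) :
    feasible m r ⊆ convexHull ℝ (Set.range fun σ : Equiv.Perm (Fin m) => firstVertex m r ∘ σ) := by
  intro p hp
  rw [← hypersimplexMatrix_mulVec_firstVertex hr hp]
  exact mulVec_mem_convexHull_range_comp_perm (hypersimplexMatrix_mem_doublyStochastic hr hp) _

end Hypersimplex

section Sequences

/-- The sequences of eigenvalues `eig X` of positive semidefinite matrices: nonincreasing and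
nonnegative. Since `eig X` vanishes past the size of `X`, no length is recorded. -/
structure IsSpectrum (β : ℕ → ℝ) : Prop where
  antitone : Antitone β
  nonneg : ∀ i, 0 ≤ β i

variable {m k : ℕ} {w : ℕ → ℝ}

theorem sum_mul_le_sum_mul_of_crossing {y z : ℕ → ℝ} (hkm : k ≤ m) (hw : Monotone w)
    (hle : ∀ i < k, y i ≤ z i) (hnonneg : ∀ i, k ≤ i → i < m → 0 ≤ y i)
    (hsum : ∑ i ∈ range m, y i = ∑ i ∈ range k, z i) :
    ∑ i ∈ range k, w i * z i ≤ ∑ i ∈ range m, w i * y i := by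
  rw [← sum_range_add_sum_Ico _ hkm] at hsum ⊢
  have hhead : ∑ i ∈ range k, w k * (y i - z i) ≤ ∑ i ∈ range k, w i * (y i - z i) :=
    sum_le_sum fun i hi => mul_le_mul_of_nonpos_right (hw (mem_range.1 hi).le)
      (sub_nonpos.2 (hle i (mem_range.1 hi)))
  have htail : ∑ i ∈ Ico k m, w k * y i ≤ ∑ i ∈ Ico k m, w i * y i :=
    sum_le_sum fun i hi => mul_le_mul_of_nonneg_right (hw (mem_Ico.1 hi).1)
      (hnonneg i (mem_Ico.1 hi).1 (mem_Ico.1 hi).2)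
  simp only [mul_sub, sum_sub_distrib, ← mul_sum] at hhead htail ⊢
  linear_combination hhead + htail - w k * hsum

theorem sum_range_le_sum_mul_of_mem_feasible {p : Fin m → ℝ} (hkm : k ≤ m) (hw : Monotone w)
    (hp : p ∈ feasible m k) : ∑ i ∈ range k, w i ≤ ∑ i : Fin m, w i * p i := by
  let y : ℕ → ℝ := fun i => if h : i < m then p ⟨i, h⟩ else 0
  have hy : ∀ i : Fin m, y i = p i := fun i => dif_pos i.2
  have hcross := sum_mul_le_sum_mul_of_crossing (y := y) (z := fun _ => 1) hkm hw
    (fun i hi => (hy ⟨i, hi.trans_le hkm⟩).trans_le (hp.1 _).2)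
    (fun i _ hi => (hp.1 _).1.trans_eq (hy ⟨i, hi⟩).symm)
    (by simpa [sum_range (n := m), hy] using hp.2)
  simpa [sum_range (n := m), hy] using hcross

end Sequences

section WaterFilling

/-- The common value `(1 / (k - ι)) ∑_{i > ι} β_i` of the levelled entries in `waterFill`. -/
noncomputable def waterLevel (m k : ℕ) (β : ℕ → ℝ) : ℝ :=
  (∑ j ∈ Ico (iota m k β) m, β j) / (k - iota m k β)

/-- The sequence `μ` with `μ_i = β_i` for `i ≤ ι` and `μ_i` equal to the water level for `i > ι`:
the most even sequence of length `k` that has the sum of `β_1, …, β_m` and dominates `β`. -/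
noncomputable def waterFill (m k : ℕ) (β : ℕ → ℝ) (i : ℕ) : ℝ := max (β i) (waterLevel m k β)

/-- `∑_{i ≤ k} 1 / (μ_i + λ)`, with `μ` the water filling of `β`. It specializes to `φ` for `λ = 0`,
to the trace of the regularized inverse for `k = m`, and is the convex envelope of `Γ`. -/
noncomputable def phiReg (m k : ℕ) (lam : ℝ) (β : ℕ → ℝ) : ℝ :=
  ∑ i ∈ range k, 1 / (waterFill m k β i + lam)

/-- The weights of the linear functional tangent to `phiReg m k lam` at `β`, up to sign. -/
noncomputable def slope (m k : ℕ) (lam : ℝ) (β : ℕ → ℝ) (i : ℕ) : ℝ :=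
  1 / (waterFill m k β i + lam) ^ 2

variable {m k : ℕ} {lam : ℝ} {β γ : ℕ → ℝ}

theorem isIota_iota (hk : 1 ≤ k) (hkm : k ≤ m) (hβ : IsSpectrum β) :
    IsIota m k β (iota m k β) :=
  Nat.sInf_mem
    (existsUnique_isIota hk hkm β (fun _ _ hij _ => hβ.antitone hij) hβ.nonneg).exists

theorem iota_lt (hk : 1 ≤ k) (hkm : k ≤ m) (hβ : IsSpectrum β) : iota m k β < k :=
  (isIota_iota hk hkm hβ).1

theorem sub_iota_mul_waterLevel (hk : 1 ≤ k) (hkm : k ≤ m) (hβ : IsSpectrum β) :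
    ((k : ℝ) - iota m k β) * waterLevel m k β = ∑ j ∈ Ico (iota m k β) m, β j :=
  mul_div_cancel₀ _ (sub_pos.2 (Nat.cast_lt.2 (iota_lt hk hkm hβ))).ne'

theorem waterFill_of_lt_iota (hk : 1 ≤ k) (hkm : k ≤ m) (hβ : IsSpectrum β) {i : ℕ}
    (hi : i < iota m k β) : waterFill m k β i = β i := by
  have hlt : waterLevel m k β < β (iota m k β - 1) := by
    rw [waterLevel, ← one_div_mul_eq_div]
    exact (isIota_iota hk hkm hβ).2.1.resolve_left (Nat.ne_zero_of_lt hi)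
  exact max_eq_left (hlt.le.trans (hβ.antitone (Nat.le_sub_one_of_lt hi)))

theorem le_waterLevel (hk : 1 ≤ k) (hkm : k ≤ m) (hβ : IsSpectrum β) {i : ℕ}
    (hi : iota m k β ≤ i) : β i ≤ waterLevel m k β := by
  rw [waterLevel, ← one_div_mul_eq_div]
  exact (hβ.antitone hi).trans (isIota_iota hk hkm hβ).2.2

theorem waterFill_of_iota_le (hk : 1 ≤ k) (hkm : k ≤ m) (hβ : IsSpectrum β) {i : ℕ}
    (hi : iota m k β ≤ i) : waterFill m k β i = waterLevel m k β :=
  max_eq_right (le_waterLevel hk hkm hβ hi)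

theorem waterLevel_nonneg (hk : 1 ≤ k) (hkm : k ≤ m) (hβ : IsSpectrum β) :
    0 ≤ waterLevel m k β :=
  (hβ.nonneg _).trans (le_waterLevel hk hkm hβ le_rfl)

theorem waterLevel_pos (hk : 1 ≤ k) (hkm : k ≤ m) (hβ : IsSpectrum β) (h : 0 < β (k - 1)) :
    0 < waterLevel m k β :=
  h.trans_le (le_waterLevel hk hkm hβ (Nat.le_sub_one_of_lt (iota_lt hk hkm hβ)))

theorem waterFill_add_pos (h : 0 < waterLevel m k β + lam) (i : ℕ) :
    0 < waterFill m k β i + lam :=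
  h.trans_le (add_le_add_left (le_max_right _ _) lam)

theorem slope_monotone (hβ : IsSpectrum β) (h : 0 < waterLevel m k β + lam) :
    Monotone (slope m k lam β) := fun _ j hij =>
  one_div_le_one_div_of_le (pow_pos (waterFill_add_pos h j) 2)
    (pow_le_pow_left₀ (waterFill_add_pos h j).le
      (add_le_add_left (max_le_max_right _ (hβ.antitone hij)) lam) 2)

/-- Only `∑_{i > ι} μ_i = ∑_{i > ι} β_i` is used: on these indices `μ` is constant, so that `f ∘ μ`
factors out. -/
theorem sum_mul_waterFill (hk : 1 ≤ k) (hkm : k ≤ m) (hβ : IsSpectrum β) (f : ℝ → ℝ) :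
    ∑ i ∈ range k, f (waterFill m k β i) * waterFill m k β i =
      ∑ i ∈ range m, f (waterFill m k β i) * β i := by
  have hιk := (iota_lt hk hkm hβ).le
  have hlevel : ∀ i, iota m k β ≤ i → waterFill m k β i = waterLevel m k β :=
    fun i => waterFill_of_iota_le hk hkm hβ
  rw [← sum_range_add_sum_Ico _ hιk, ← sum_range_add_sum_Ico _ (hιk.trans hkm)]
  congr 1
  · exact sum_congr rfl fun i hi => by rw [waterFill_of_lt_iota hk hkm hβ (mem_range.1 hi)]
  · calc ∑ i ∈ Ico (iota m k β) k, f (waterFill m k β i) * waterFill m k β i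
        = f (waterLevel m k β) * ((k - iota m k β) * waterLevel m k β) := by
          rw [sum_congr rfl fun i hi => by rw [hlevel i (mem_Ico.1 hi).1], sum_const,
            Nat.card_Ico, nsmul_eq_mul, Nat.cast_sub hιk]
          ring
      _ = ∑ i ∈ Ico (iota m k β) m, f (waterFill m k β i) * β i := by
          rw [sub_iota_mul_waterLevel hk hkm hβ, mul_sum]
          exact sum_congr rfl fun i hi => by rw [hlevel i (mem_Ico.1 hi).1]

theorem sum_waterFill (hk : 1 ≤ k) (hkm : k ≤ m) (hβ : IsSpectrum β) :
    ∑ i ∈ range k, waterFill m k β i = ∑ i ∈ range m, β i := by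
  simpa using sum_mul_waterFill hk hkm hβ fun _ => 1

theorem sum_mul_waterFill_le (hk : 1 ≤ k) (hkm : k ≤ m) (hβ : IsSpectrum β) {w : ℕ → ℝ}
    (hw : Monotone w) :
    ∑ i ∈ range k, w i * waterFill m k β i ≤ ∑ i ∈ range m, w i * β i :=
  sum_mul_le_sum_mul_of_crossing hkm hw (fun _ _ => le_max_left _ _)
    (fun i _ _ => hβ.nonneg i) (sum_waterFill hk hkm hβ).symm

theorem phi_eq_phiReg_zero (hk : 1 ≤ k) (hkm : k ≤ m) (hβ : IsSpectrum β) :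
    phi m k β = phiReg m k 0 β := by
  have hιk := (iota_lt hk hkm hβ).le
  rw [phi, phiReg, ← sum_range_add_sum_Ico _ hιk]
  refine congrArg₂ _ ?_ (Eq.symm ?_)
  · exact sum_congr rfl fun i hi => by
      rw [waterFill_of_lt_iota hk hkm hβ (mem_range.1 hi), add_zero]
  · rw [sum_congr rfl fun i hi => by
        rw [waterFill_of_iota_le hk hkm hβ (mem_Ico.1 hi).1, add_zero], sum_const,
      Nat.card_Ico, nsmul_eq_mul, Nat.cast_sub hιk, waterLevel, one_div_div, mul_div_assoc', sq]

theorem phiReg_self (hm : 1 ≤ m) (hβ : IsSpectrum β) :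
    phiReg m m lam β = ∑ i ∈ range m, 1 / (β i + lam) := by
  have hfill := (sum_eq_sum_iff_of_le fun i _ => le_max_left (β i) (waterLevel m m β)).1
    (sum_waterFill hm le_rfl hβ).symm
  exact sum_congr rfl fun i hi => by rw [waterFill, ← hfill i hi]

theorem tangent_le_one_div {s t : ℝ} (hs : 0 < s) (ht : 0 < t) :
    1 / s - 1 / s ^ 2 * (t - s) ≤ 1 / t := by
  have hsq : 1 / t - (1 / s - 1 / s ^ 2 * (t - s)) = (t - s) ^ 2 / (s ^ 2 * t) := by
    field_simp
    ring
  exact sub_nonneg.1 (hsq ▸ by positivity)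

theorem phiReg_sub_le_sum_one_div (hk : 1 ≤ k) (hkm : k ≤ m) (hβ : IsSpectrum β)
    (hpos : 0 < waterLevel m k β + lam) {y : ℕ → ℝ} (hy : ∀ i, 0 < y i + lam) :
    phiReg m k lam β -
        (∑ i ∈ range k, slope m k lam β i * y i - ∑ i ∈ range m, slope m k lam β i * β i) ≤
      ∑ i ∈ range k, 1 / (y i + lam) := by
  have hbase := sum_mul_waterFill hk hkm hβ fun t => 1 / (t + lam) ^ 2
  simp only [phiReg, slope, ← hbase, ← sum_sub_distrib]
  refine sum_le_sum fun i _ => ?_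
  linear_combination tangent_le_one_div (waterFill_add_pos hpos i) (hy i)

theorem phiReg_sub_le_phiReg (hk : 1 ≤ k) (hkm : k ≤ m) (hβ : IsSpectrum β) (hγ : IsSpectrum γ)
    (hpos : 0 < waterLevel m k β + lam) (hposγ : 0 < waterLevel m k γ + lam) :
    phiReg m k lam β -
        (∑ i ∈ range m, slope m k lam β i * γ i - ∑ i ∈ range m, slope m k lam β i * β i) ≤
      phiReg m k lam γ := by
  have htangent := phiReg_sub_le_sum_one_div hk hkm hβ hpos (waterFill_add_pos hposγ)
  have hfill := sum_mul_waterFill_le hk hkm hγ (slope_monotone hβ hpos)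
  rw [phiReg.eq_1 m k lam γ]
  linarith

theorem phiReg_le_phiReg_add {d r : ℕ} {lam' : ℝ} {σ : ℕ → ℝ} (hk : 1 ≤ k) (hkm : k ≤ m)
    (hβ : IsSpectrum β) (hpos : 0 < waterLevel m k β + lam) (hr : 1 ≤ r) (hrd : r ≤ d)
    (hrk : r ≤ k) (hσ : IsSpectrum σ) (hlam' : 0 < lam')
    (hdom : ∀ w : ℕ → ℝ, Monotone w →
      ∑ i ∈ range d, w i * σ i + (lam' - lam) * ∑ i ∈ range k, w i ≤ ∑ i ∈ range m, w i * β i) :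
    phiReg m k lam β ≤ phiReg d r lam' σ + (k - r) / lam' := by
  let μ : ℕ → ℝ := fun i => if i < r then waterFill d r σ i else 0
  have hμ : ∀ i < r, μ i = waterFill d r σ i := fun i hi => if_pos hi
  have hμ0 : ∀ i, r ≤ i → μ i = 0 := fun i hi => if_neg (not_lt.2 hi)
  have hsplit : ∀ g : ℕ → ℝ → ℝ, ∑ i ∈ range k, g i (μ i) =
      ∑ i ∈ range r, g i (waterFill d r σ i) + ∑ i ∈ Ico r k, g i 0 := fun g => by
    rw [← sum_range_add_sum_Ico _ hrk]
    exact congrArg₂ _ (sum_congr rfl fun i hi => by rw [hμ i (mem_range.1 hi)])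
      (sum_congr rfl fun i hi => by rw [hμ0 i (mem_Ico.1 hi).1])
  have hμ_nonneg : ∀ i, 0 ≤ μ i := fun i => by
    rcases lt_or_ge i r with hi | hi
    · exact (hσ.nonneg i).trans ((le_max_left _ _).trans_eq (hμ i hi).symm)
    · exact (hμ0 i hi).ge
  have hweight : ∑ i ∈ range k, slope m k lam β i * μ i ≤
      ∑ i ∈ range d, slope m k lam β i * σ i := by
    rw [hsplit fun i t => slope m k lam β i * t]
    simpa using sum_mul_waterFill_le hr hrd hσ (slope_monotone hβ hpos)
  have hvalue : ∑ i ∈ range k, 1 / (μ i + lam') = phiReg d r lam' σ + (k - r) / lam' := by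
    rw [hsplit fun _ t => 1 / (t + lam'), phiReg]
    simp [Nat.cast_sub hrk, div_eq_mul_inv]
  have htangent := phiReg_sub_le_sum_one_div hk hkm hβ hpos (y := fun i => μ i + (lam' - lam))
    fun i => by linarith [hμ_nonneg i]
  simp only [mul_add, sum_add_distrib, ← sum_mul, add_assoc, sub_add_cancel] at htangent
  linarith [hdom _ (slope_monotone hβ hpos)]

end WaterFilling

section Eigenvalues

variable {m n d : ℕ} {X Y Q : Matrix (Fin m) (Fin m) ℝ} {w : ℕ → ℝ}

/-- `v ↦ Q diag(v) Qᵀ`. For orthogonal `Q` this parametrizes the symmetric matrices that are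
diagonal in the basis of the columns of `Q`. -/
def conjDiagonal (Q : Matrix (Fin m) (Fin m) ℝ) : (Fin m → ℝ) →ₗ[ℝ] Matrix (Fin m) (Fin m) ℝ :=
  LinearMap.mulRight ℝ Qᵀ ∘ₗ LinearMap.mulLeft ℝ Q ∘ₗ diagonalLinearMap (Fin m) ℝ ℝ

theorem conjDiagonal_apply (Q : Matrix (Fin m) (Fin m) ℝ) (v : Fin m → ℝ) :
    conjDiagonal Q v = Q * diagonal v * Qᵀ := rfl

theorem conjDiagonal_one (hQ : Qᵀ * Q = 1) : conjDiagonal Q 1 = 1 := by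
  have hone : diagonal (1 : Fin m → ℝ) = 1 := diagonal_one
  rw [conjDiagonal_apply, hone, Matrix.mul_one, mul_eq_one_comm.1 hQ]

theorem conjDiagonal_mul_conjDiagonal (hQ : Qᵀ * Q = 1) (u v : Fin m → ℝ) :
    conjDiagonal Q u * conjDiagonal Q v = conjDiagonal Q (u * v) := by
  calc Q * diagonal u * Qᵀ * (Q * diagonal v * Qᵀ)
      = Q * diagonal u * (Qᵀ * Q) * diagonal v * Qᵀ := by simp only [Matrix.mul_assoc]
    _ = Q * (diagonal u * diagonal v) * Qᵀ := by rw [hQ, Matrix.mul_one, Matrix.mul_assoc Q]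
    _ = conjDiagonal Q (u * v) := by rw [diagonal_mul_diagonal, conjDiagonal_apply]; rfl

theorem trace_conjDiagonal (hQ : Qᵀ * Q = 1) (v : Fin m → ℝ) :
    (conjDiagonal Q v).trace = ∑ i, v i := by
  rw [conjDiagonal_apply, trace_mul_comm, ← Matrix.mul_assoc, hQ, Matrix.one_mul, trace_diagonal]

theorem charpoly_conjDiagonal (hQ : Qᵀ * Q = 1) (v : Fin m → ℝ) :
    (conjDiagonal Q v).charpoly = ∏ i, (Polynomial.X - Polynomial.C (v i)) := by
  rw [conjDiagonal_apply, charpoly_mul_comm, ← Matrix.mul_assoc, hQ, Matrix.one_mul,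
    charpoly_diagonal]

theorem roots_charpoly_conjDiagonal (hQ : Qᵀ * Q = 1) (v : Fin m → ℝ) :
    (conjDiagonal Q v).charpoly.roots = univ.val.map v := by
  rw [charpoly_conjDiagonal hQ]
  have hprod : ∏ i, (Polynomial.X - Polynomial.C (v i)) =
      ((univ.val.map v).map fun a => Polynomial.X - Polynomial.C a).prod := by
    rw [Multiset.map_map]
    rfl
  rw [hprod, Polynomial.roots_multiset_prod_X_sub_C]

theorem posSemidef_conjDiagonal (Q : Matrix (Fin m) (Fin m) ℝ) {v : Fin m → ℝ} (hv : 0 ≤ v) :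
    (conjDiagonal Q v).PosSemidef := by
  simpa [conjDiagonal_apply] using (PosSemidef.diagonal hv).mul_mul_conjTranspose_same Q

theorem isHermitian_conjDiagonal (Q : Matrix (Fin m) (Fin m) ℝ) (v : Fin m → ℝ) :
    (conjDiagonal Q v).IsHermitian := by
  simpa [conjDiagonal_apply] using isHermitian_mul_mul_conjTranspose Q (isHermitian_diagonal v)

theorem trace_conjDiagonal_mul_conjDiagonal (Q V : Matrix (Fin m) (Fin m) ℝ) (u v : Fin m → ℝ) :
    (conjDiagonal Q u * conjDiagonal V v).trace =
      u ⬝ᵥ (of fun i j => (Qᵀ * V) i j ^ 2) *ᵥ v := by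
  set R := Qᵀ * V with hR
  have hcycle : (conjDiagonal Q u * conjDiagonal V v).trace =
      (diagonal u * (R * diagonal v * Rᵀ)).trace := by
    rw [conjDiagonal_apply, conjDiagonal_apply, Matrix.mul_assoc, Matrix.mul_assoc,
      trace_mul_comm Q, hR, transpose_mul, transpose_transpose]
    simp only [Matrix.mul_assoc]
  have hdiag : ∀ i, (R * diagonal v * Rᵀ) i i = ((of fun i j => R i j ^ 2) *ᵥ v) i := fun i => by
    simp only [Matrix.mul_apply (M := R * diagonal v), mul_diagonal, transpose_apply, mulVec,
      dotProduct, of_apply]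
    exact sum_congr rfl fun j _ => by ring
  rw [hcycle]
  exact sum_congr rfl fun i _ => by rw [diag_apply, diagonal_mul, hdiag]

theorem exists_equiv_eigenvalues_eq_eig (hX : X.IsHermitian) :
    ∃ e : Fin m ≃ Fin m, ∀ i, hX.eigenvalues (e i) = eig X i := by
  refine ⟨(finCongr (Fintype.card_fin m).symm).trans
    (Fintype.equivOfCardEq (Fintype.card_fin (Fintype.card (Fin m)))), fun i => ?_⟩
  rw [eig, dif_pos ⟨hX, i.2⟩, IsHermitian.eigenvalues, Equiv.trans_apply, Equiv.symm_apply_apply]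
  rfl

theorem exists_conjDiagonal_eig_eq (hX : X.IsHermitian) :
    ∃ Q : Matrix (Fin m) (Fin m) ℝ, Qᵀ * Q = 1 ∧ conjDiagonal Q (fun i => eig X i) = X := by
  obtain ⟨e, he⟩ := exists_equiv_eigenvalues_eq_eig hX
  let U : Matrix (Fin m) (Fin m) ℝ := hX.eigenvectorUnitary
  have hU : Uᵀ * U = 1 := by
    simpa [star_eq_conjTranspose] using Unitary.coe_star_mul_self hX.eigenvectorUnitary
  have hspec : X = U * diagonal hX.eigenvalues * Uᵀ := by
    have h := hX.spectral_theorem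
    rw [Unitary.conjStarAlgAut_apply] at h
    simpa [star_eq_conjTranspose, Function.comp_def] using h
  have hdiag : diagonal (fun i : Fin m => eig X i) = (diagonal hX.eigenvalues).submatrix e e := by
    rw [submatrix_diagonal_equiv]
    exact congrArg diagonal (funext fun i => (he i).symm)
  refine ⟨U.submatrix id e, ?_, ?_⟩
  · rw [transpose_submatrix, ← submatrix_mul _ _ _ id _ Function.bijective_id, hU]
    exact submatrix_one_equiv e
  · rw [conjDiagonal_apply, hdiag, transpose_submatrix, submatrix_mul_equiv, submatrix_mul_equiv,
      submatrix_id_id]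
    exact hspec.symm

theorem eig_of_le (X : Matrix (Fin m) (Fin m) ℝ) {i : ℕ} (hi : m ≤ i) : eig X i = 0 :=
  dif_neg fun h => hi.not_gt h.2

theorem isSpectrum_eig (hX : X.PosSemidef) : IsSpectrum (eig X) := by
  have hnonneg : ∀ i, 0 ≤ eig X i := fun i => by
    rcases lt_or_ge i m with hi | hi
    · obtain ⟨e, he⟩ := exists_equiv_eigenvalues_eq_eig hX.1
      exact (hX.eigenvalues_nonneg _).trans_eq (he ⟨i, hi⟩)
    · exact (eig_of_le X hi).ge
  refine ⟨fun i j hij => ?_, hnonneg⟩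
  rcases lt_or_ge j m with hj | hj
  · rw [eig, eig, dif_pos ⟨hX.1, hj⟩, dif_pos ⟨hX.1, hij.trans_lt hj⟩]
    exact hX.1.eigenvalues₀_antitone hij
  · exact (eig_of_le X hj).trans_le (hnonneg i)

theorem exists_perm_of_univ_val_map_eq {u v : Fin m → ℝ} (h : univ.val.map u = univ.val.map v) :
    ∃ τ : Equiv.Perm (Fin m), u = v ∘ τ := by
  rw [Fin.univ_val_map, Fin.univ_val_map, Multiset.coe_eq_coe] at h
  have hsorted : u ∘ Tuple.sort u = v ∘ Tuple.sort v :=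
    List.ofFn_injective <| (((Tuple.sort u).ofFn_comp_perm u).trans
      (h.trans ((Tuple.sort v).ofFn_comp_perm v).symm)).eq_of_sortedLE
      (Tuple.monotone_sort u).sortedLE_ofFn (Tuple.monotone_sort v).sortedLE_ofFn
  refine ⟨(Tuple.sort u).symm.trans (Tuple.sort v), funext fun i => ?_⟩
  simpa using congrFun hsorted ((Tuple.sort u).symm i)

theorem roots_charpoly_eq_map_eig_univ (hX : X.IsHermitian) :
    X.charpoly.roots = univ.val.map fun i : Fin m => eig X i := by
  obtain ⟨Q, hQ, h⟩ := exists_conjDiagonal_eig_eq hX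
  rw [← roots_charpoly_conjDiagonal hQ, h]

theorem exists_perm_eig_conjDiagonal (hQ : Qᵀ * Q = 1) (v : Fin m → ℝ) :
    ∃ τ : Equiv.Perm (Fin m), (fun i : Fin m => eig (conjDiagonal Q v) i) = v ∘ τ := by
  have hherm := isHermitian_conjDiagonal Q v
  exact exists_perm_of_univ_val_map_eq
    ((roots_charpoly_eq_map_eig_univ hherm).symm.trans (roots_charpoly_conjDiagonal hQ v))

theorem eq_of_map_range_eq_of_antitone {N : ℕ} {f g : ℕ → ℝ} (hf : Antitone f) (hg : Antitone g)
    (h : (Multiset.range N).map f = (Multiset.range N).map g) {i : ℕ} (hi : i < N) :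
    f i = g i := by
  have hlist : (List.range N).map f = (List.range N).map g :=
    (Multiset.coe_eq_coe.1 h).eq_of_sortedGE
      (List.pairwise_map.2 (List.pairwise_le_range.imp fun hij => hf hij)).sortedGE
      (List.pairwise_map.2 (List.pairwise_le_range.imp fun hij => hg hij)).sortedGE
  exact List.map_inj_left.1 hlist i (List.mem_range.2 hi)

theorem map_eig_range_add (hX : X.IsHermitian) (e : ℕ) :
    (Multiset.range (m + e)).map (eig X) = X.charpoly.roots + e • {0} := by
  have hhead : (Multiset.range m).map (eig X) = X.charpoly.roots := by
    rw [roots_charpoly_eq_map_eig_univ hX, Fin.univ_val_map, List.ofFn_eq_map, Multiset.range,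
      ← List.map_coe_finRange_eq_range, Multiset.map_coe, List.map_map]
    rfl
  have htail : ((Multiset.range e).map (m + ·)).map (eig X) = e • {0} := by
    simp [eig_of_le, Multiset.map_const', Multiset.nsmul_singleton]
  rw [Multiset.range_add, Multiset.map_add, hhead, htail]

theorem eig_transpose_mul_self (Z : Matrix (Fin d) (Fin n) ℝ) (i : ℕ) :
    eig (Zᵀ * Z) i = eig (Z * Zᵀ) i := by
  have hleft : (Zᵀ * Z).PosSemidef := by simpa using posSemidef_conjTranspose_mul_self Z
  have hright : (Z * Zᵀ).PosSemidef := by simpa using posSemidef_self_mul_conjTranspose Z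
  rcases le_or_gt (n + d) i with hi | hi
  · rw [eig_of_le _ (le_self_add.trans hi), eig_of_le _ (le_add_self.trans hi)]
  refine eq_of_map_range_eq_of_antitone (isSpectrum_eig hleft).antitone
    (isSpectrum_eig hright).antitone ?_ hi
  have hroots := congrArg Polynomial.roots (charpoly_mul_comm' Zᵀ Z)
  have hne : ∀ {k : ℕ} (j : ℕ) (M : Matrix (Fin k) (Fin k) ℝ),
      Polynomial.X ^ j * M.charpoly ≠ 0 := fun j M =>
    ((Polynomial.monic_X_pow j).mul M.charpoly_monic).ne_zero
  rw [Polynomial.roots_mul (hne _ _), Polynomial.roots_mul (hne _ _), Polynomial.roots_X_pow,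
    Polynomial.roots_X_pow, Fintype.card_fin, Fintype.card_fin] at hroots
  rw [map_eig_range_add hleft.1, add_comm n d, map_eig_range_add hright.1, add_comm, hroots,
    add_comm]

theorem sum_range_mul_eig_of_le {N : ℕ} (h : m ≤ N) (X : Matrix (Fin m) (Fin m) ℝ) (w : ℕ → ℝ) :
    ∑ i ∈ range N, w i * eig X i = ∑ i ∈ range m, w i * eig X i :=
  (sum_subset (range_mono h) fun i _ hi => by
    rw [eig_of_le X (not_lt.1 (mem_range.not.1 hi)), mul_zero]).symm

theorem sum_mul_eig_transpose_mul_self (Z : Matrix (Fin d) (Fin n) ℝ) (w : ℕ → ℝ) :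
    ∑ i ∈ range n, w i * eig (Zᵀ * Z) i = ∑ i ∈ range d, w i * eig (Z * Zᵀ) i := by
  rw [← sum_range_mul_eig_of_le (le_max_left n d), ← sum_range_mul_eig_of_le (le_max_right n d)]
  simp only [eig_transpose_mul_self]

theorem sum_mul_eig_le_trace (hY : Y.PosSemidef) (hQ : Qᵀ * Q = 1) (hw : Monotone w) :
    ∑ i ∈ range m, w i * eig Y i ≤ (conjDiagonal Q (fun i => w i) * Y).trace := by
  obtain ⟨V, hV, h⟩ := exists_conjDiagonal_eig_eq hY.1
  have horth : (Qᵀ * V)ᵀ * (Qᵀ * V) = 1 := by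
    rw [transpose_mul, transpose_transpose, Matrix.mul_assoc, ← Matrix.mul_assoc Q,
      mul_eq_one_comm.1 hQ, Matrix.one_mul, hV]
  have hvary : Antivary (fun i : Fin m => w i) fun i : Fin m => eig Y i := fun i j hij =>
    hw (le_of_not_ge fun hle => hij.not_ge ((isSpectrum_eig hY).antitone hle))
  calc ∑ i ∈ range m, w i * eig Y i
      = (fun i : Fin m => w i) ⬝ᵥ fun i : Fin m => eig Y i := sum_range _
    _ ≤ _ := dotProduct_le_dotProduct_mulVec_of_antivary hvary (sq_mem_doublyStochastic horth)
    _ = (conjDiagonal Q (fun i => w i) * Y).trace := by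
        rw [← trace_conjDiagonal_mul_conjDiagonal, h]

theorem trace_conjDiagonal_mul_of_eq (hQ : Qᵀ * Q = 1)
    (hX : conjDiagonal Q (fun i => eig X i) = X) (w : ℕ → ℝ) :
    (conjDiagonal Q (fun i => w i) * X).trace = ∑ i ∈ range m, w i * eig X i := by
  nth_rw 1 [← hX]
  rw [conjDiagonal_mul_conjDiagonal hQ, trace_conjDiagonal hQ, sum_range]
  rfl

theorem sum_mul_eig_add_smul_le (hX : X.PosSemidef) (hY : Y.PosSemidef) {c : ℝ} (hc : 0 ≤ c)
    (hw : Monotone w) :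
    ∑ i ∈ range m, w i * eig X i + c * ∑ i ∈ range m, w i * eig Y i ≤
      ∑ i ∈ range m, w i * eig (X + c • Y) i := by
  obtain ⟨Q, hQ, h⟩ := exists_conjDiagonal_eig_eq (hX.add (hY.smul hc)).1
  rw [← trace_conjDiagonal_mul_of_eq hQ h, Matrix.mul_add, Matrix.mul_smul, trace_add, trace_smul,
    smul_eq_mul]
  exact add_le_add (sum_mul_eig_le_trace hX hQ hw)
    (mul_le_mul_of_nonneg_left (sum_mul_eig_le_trace hY hQ hw) hc)

theorem comp_perm_mem_feasible {k : ℕ} {p : Fin m → ℝ} (hp : p ∈ feasible m k)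
    (σ : Equiv.Perm (Fin m)) : p ∘ σ ∈ feasible m k :=
  ⟨fun i => hp.1 (σ i), (Equiv.sum_comp σ p).trans hp.2⟩

theorem sum_range_le_sum_mul_eig_diagonal {k : ℕ} {p : Fin m → ℝ} (hkm : k ≤ m) (hw : Monotone w)
    (hp : p ∈ feasible m k) :
    ∑ i ∈ range k, w i ≤ ∑ i ∈ range m, w i * eig (diagonal p) i := by
  obtain ⟨τ, hτ⟩ := exists_perm_eig_conjDiagonal (Q := 1) (by simp) p
  rw [conjDiagonal_apply, Matrix.one_mul, transpose_one, Matrix.mul_one] at hτ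
  have hle := sum_range_le_sum_mul_of_mem_feasible hkm hw (comp_perm_mem_feasible hp τ)
  rwa [← hτ, ← sum_range fun i => w i * eig (diagonal p) i] at hle

theorem trace_inv_add_smul_one {lam : ℝ} (hX : X.PosSemidef) (hlam : 0 < lam) :
    ((X + lam • (1 : Matrix (Fin m) (Fin m) ℝ))⁻¹).trace =
      ∑ i ∈ range m, 1 / (eig X i + lam) := by
  obtain ⟨Q, hQ, h⟩ := exists_conjDiagonal_eig_eq hX.1
  let v : Fin m → ℝ := fun i => eig X i + lam
  have hsum : X + lam • (1 : Matrix (Fin m) (Fin m) ℝ) = conjDiagonal Q v := by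
    nth_rw 1 [← h]
    rw [← conjDiagonal_one hQ, ← map_smul, ← map_add]
    exact congrArg _ (funext fun i => by simp [v])
  have hv : v * v⁻¹ = 1 := funext fun i =>
    mul_inv_cancel₀ (add_pos_of_nonneg_of_pos ((isSpectrum_eig hX).nonneg i) hlam).ne'
  have hinv : (conjDiagonal Q v)⁻¹ = conjDiagonal Q v⁻¹ := inv_eq_right_inv <| by
    rw [conjDiagonal_mul_conjDiagonal hQ, hv, conjDiagonal_one hQ]
  rw [hsum, hinv, trace_conjDiagonal hQ, sum_range]
  simp [v]

end Eigenvalues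

section ConvexEnvelope

theorem hasSubgradientsOn_phiReg_eig {m k : ℕ} {lam : ℝ} {s : Set (Matrix (Fin m) (Fin m) ℝ)}
    (hk : 1 ≤ k) (hkm : k ≤ m)
    (hs : ∀ X ∈ s, X.PosSemidef ∧ 0 < waterLevel m k (eig X) + lam) :
    HasSubgradientsOn s fun X => phiReg m k lam (eig X) := by
  intro X hX
  obtain ⟨hXpsd, hXpos⟩ := hs X hX
  obtain ⟨Q, hQ, hdiag⟩ := exists_conjDiagonal_eig_eq hXpsd.1
  let W := conjDiagonal Q fun i => slope m k lam (eig X) i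
  refine ⟨-(traceLinearMap (Fin m) ℝ ℝ ∘ₗ LinearMap.mulLeft ℝ W), fun Y hY => ?_⟩
  obtain ⟨hYpsd, hYpos⟩ := hs Y hY
  have hL : (-(traceLinearMap (Fin m) ℝ ℝ ∘ₗ LinearMap.mulLeft ℝ W)) (Y - X) =
      (W * X).trace - (W * Y).trace := by
    simp [Matrix.mul_sub, trace_sub]
  have hXtrace := trace_conjDiagonal_mul_of_eq hQ hdiag (slope m k lam (eig X))
  have hYtrace := sum_mul_eig_le_trace hYpsd hQ (slope_monotone (isSpectrum_eig hXpsd) hXpos)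
  have htangent := phiReg_sub_le_phiReg hk hkm (isSpectrum_eig hXpsd) (isSpectrum_eig hYpsd)
    hXpos hYpos
  rw [hL]
  linarith

theorem convEnvelope_eq_of_forall_le {E : Type*} [AddCommGroup E] [Module ℝ E] {s : Set E}
    {f g : E → ℝ} {x : E} (hg : ConvexOn ℝ s g) (hgf : ∀ z ∈ s, g z ≤ f z)
    (hmax : ∀ h : E → ℝ, ConvexOn ℝ s h → (∀ z ∈ s, h z ≤ f z) → h x ≤ g x) :
    convEnvelope s f x = g x :=
  IsGreatest.csSup_eq ⟨⟨g, hg, hgf, rfl⟩, by rintro _ ⟨h, hh, hhf, rfl⟩; exact hmax h hh hhf⟩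

theorem convex_psdCone (d : ℕ) : Convex ℝ (psdCone d) :=
  fun _ hX _ hY _ _ ha hb _ => (hX.smul ha).add (hY.smul hb)

variable {d k : ℕ} {lam : ℝ} {Q X : Matrix (Fin d) (Fin d) ℝ} {p v : Fin d → ℝ}
  {g : Matrix (Fin d) (Fin d) ℝ → ℝ}

theorem Gam_conjDiagonal_le (hlam : 0 < lam) (hQ : Qᵀ * Q = 1) (hv : 0 ≤ v)
    (hp : p ∈ feasible d (min k d)) :
    Gam k lam (conjDiagonal Q v) ≤ (fun i => 1 / (v i + lam)) ⬝ᵥ p := by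
  obtain ⟨τ, hτ⟩ := exists_perm_eig_conjDiagonal hQ v
  have hspec := isSpectrum_eig (posSemidef_conjDiagonal Q hv)
  have hw : Monotone fun i => 1 / (eig (conjDiagonal Q v) i + lam) := fun i j hij =>
    one_div_le_one_div_of_le (add_pos_of_nonneg_of_pos (hspec.nonneg j) hlam)
      (add_le_add_left (hspec.antitone hij) lam)
  calc Gam k lam (conjDiagonal Q v)
      ≤ ∑ i : Fin d, 1 / (eig (conjDiagonal Q v) i + lam) * (p ∘ τ) i :=
        sum_range_le_sum_mul_of_mem_feasible (min_le_right k d) hw (comp_perm_mem_feasible hp τ)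
    _ = ∑ i, 1 / (v (τ i) + lam) * p (τ i) := by simp only [congrFun hτ _, Function.comp_apply]
    _ = (fun i => 1 / (v i + lam)) ⬝ᵥ p := Equiv.sum_comp τ fun i => 1 / (v i + lam) * p i

/-- The left side is convex and the right side linear in `p`, so that only the vertices of the
hypersimplex matter, where `p_i` is `0` or `1`. -/
theorem le_dotProduct_of_convexOn_of_le_Gam (hlam : 0 < lam) (hQ : Qᵀ * Q = 1)
    (hg : ConvexOn ℝ (psdCone d) g) (hgΓ : ∀ Y ∈ psdCone d, g Y ≤ Gam k lam Y) (hv : 0 ≤ v)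
    (hp : p ∈ feasible d (min k d)) :
    g (conjDiagonal Q (v * p)) ≤ (fun i => 1 / (v i + lam)) ⬝ᵥ p := by
  let u : Fin d → ℝ := fun i => 1 / (v i + lam)
  have hlin : IsLinearMap ℝ (u ⬝ᵥ ·) := ⟨dotProduct_add u, fun c y => dotProduct_smul c u y⟩
  have hconv : ConvexOn ℝ (Set.Ici 0) fun q => g (conjDiagonal Q (v * q)) - u ⬝ᵥ q :=
    ((hg.comp_linearMap (conjDiagonal Q ∘ₗ LinearMap.mulLeft ℝ v)).subset
      (fun q hq => posSemidef_conjDiagonal Q (mul_nonneg hv hq)) (convex_Ici 0)).sub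
      (hlin.mk'.concaveOn (convex_Ici 0))
  have hvertex : ∀ σ : Equiv.Perm (Fin d), firstVertex d (min k d) ∘ σ ∈ feasible d (min k d) :=
    comp_perm_mem_feasible (firstVertex_mem_feasible (min_le_right k d))
  obtain ⟨_, ⟨σ, rfl⟩, hle⟩ := hconv.exists_ge_of_mem_convexHull
    (Set.range_subset_iff.2 fun σ i => ((hvertex σ).1 i).1)
    (feasible_subset_convexHull (min_le_right k d) hp)
  set q := firstVertex d (min k d) ∘ σ
  have hvq : 0 ≤ v * q := mul_nonneg hv fun i => ((hvertex σ).1 i).1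
  have hvalue : (fun i => 1 / ((v * q) i + lam)) ⬝ᵥ q = u ⬝ᵥ q := sum_congr rfl fun i _ => by
    by_cases hi : (σ i : ℕ) < min k d <;> simp [q, u, firstVertex, hi]
  have hq := (hgΓ _ (posSemidef_conjDiagonal Q hvq)).trans
    ((Gam_conjDiagonal_le hlam hQ hvq (hvertex σ)).trans_eq hvalue)
  linarith

theorem phiReg_le_Gam (hlam : 0 < lam) (hX : X.PosSemidef) :
    phiReg d (min k d) lam (eig X) ≤ Gam k lam X :=
  sum_le_sum fun i _ => one_div_le_one_div_of_le
    (add_pos_of_nonneg_of_pos ((isSpectrum_eig hX).nonneg i) hlam)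
    (add_le_add_left (le_max_left _ _) lam)

theorem phiReg_eq_Gam_of_waterLevel_eq_zero (hX : X.PosSemidef)
    (h : waterLevel d (min k d) (eig X) = 0) :
    phiReg d (min k d) lam (eig X) = Gam k lam X :=
  sum_congr rfl fun i _ => by rw [waterFill, h, max_eq_left ((isSpectrum_eig hX).nonneg i)]

/-- Dividing the eigenvalues by their water filling `μ` gives a point `p` of the hypersimplex, and
`X` has the eigenvalues `μ_i p_i`. -/
theorem le_phiReg_of_convexOn_of_le_Gam (hk : 1 ≤ k) (hd : 1 ≤ d) (hlam : 0 < lam)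
    (hX : X.PosSemidef) (hg : ConvexOn ℝ (psdCone d) g)
    (hgΓ : ∀ Y ∈ psdCone d, g Y ≤ Gam k lam Y) :
    g X ≤ phiReg d (min k d) lam (eig X) := by
  have hβ := isSpectrum_eig hX
  have hr : 1 ≤ min k d := le_min hk hd
  have hrd := min_le_right k d
  obtain hlevel | hlevel := (waterLevel_nonneg hr hrd hβ).eq_or_lt
  · exact (hgΓ X hX).trans_eq (phiReg_eq_Gam_of_waterLevel_eq_zero hX hlevel.symm).symm
  set μ := waterFill d (min k d) (eig X)
  have hμ : ∀ i, 0 < μ i := fun i => hlevel.trans_le (le_max_right _ _)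
  let p : Fin d → ℝ := fun i => eig X i / μ i
  have hp : p ∈ feasible d (min k d) := by
    refine ⟨fun i => ⟨div_nonneg (hβ.nonneg i) (hμ i).le,
      div_le_one_of_le₀ (le_max_left _ _) (hμ i).le⟩, ?_⟩
    calc ∑ i, p i = ∑ i ∈ range d, (μ i)⁻¹ * eig X i := by simp [sum_range, p, div_eq_inv_mul]
      _ = ∑ i ∈ range (min k d), (μ i)⁻¹ * μ i := (sum_mul_waterFill hr hrd hβ fun t => t⁻¹).symm
      _ = (min k d : ℕ) := by simp [inv_mul_cancel₀ (hμ _).ne']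
  have hvalue : (fun i : Fin d => 1 / (μ i + lam)) ⬝ᵥ p = phiReg d (min k d) lam (eig X) := by
    calc ∑ i : Fin d, 1 / (μ i + lam) * p i
        = ∑ i ∈ range d, 1 / (μ i + lam) / μ i * eig X i := by
          rw [sum_range]
          exact sum_congr rfl fun i _ =>
            (mul_div_assoc' _ _ _).trans (mul_div_right_comm _ _ _)
      _ = ∑ i ∈ range (min k d), 1 / (μ i + lam) / μ i * μ i :=
          (sum_mul_waterFill hr hrd hβ fun t => 1 / (t + lam) / t).symm
      _ = phiReg d (min k d) lam (eig X) :=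
          sum_congr rfl fun i _ => div_mul_cancel₀ _ (hμ i).ne'
  obtain ⟨Q, hQ, hdiag⟩ := exists_conjDiagonal_eig_eq hX.1
  have hfactor : (fun i : Fin d => eig X i) = (fun i : Fin d => μ i) * p :=
    funext fun i => (mul_div_cancel₀ _ (hμ i).ne').symm
  have hle := le_dotProduct_of_convexOn_of_le_Gam hlam hQ hg hgΓ (fun i => (hμ i).le) hp
  rwa [← hfactor, hdiag, hvalue] at hle

theorem convGam_eq_phiReg (hk : 1 ≤ k) (hd : 1 ≤ d) (hlam : 0 < lam) (hX : X.PosSemidef) :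
    convGam k lam X = phiReg d (min k d) lam (eig X) := by
  have hr : 1 ≤ min k d := le_min hk hd
  have hrd := min_le_right k d
  have hsub : HasSubgradientsOn (psdCone d) fun Y => phiReg d (min k d) lam (eig Y) :=
    hasSubgradientsOn_phiReg_eig hr hrd fun Y hY =>
      ⟨hY, add_pos_of_nonneg_of_pos (waterLevel_nonneg hr hrd (isSpectrum_eig hY)) hlam⟩
  exact convEnvelope_eq_of_forall_le (hsub.convexOn (convex_psdCone d))
    (fun _ => phiReg_le_Gam hlam)
    fun _ => le_phiReg_of_convexOn_of_le_Gam hk hd hlam hX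

end ConvexEnvelope

section Relaxations

variable {d n m k : ℕ} {lam : ℝ} {x : Fin n → ℝ}

theorem nonneg_of_mem_feasible (hx : x ∈ feasible n k) : 0 ≤ x := fun i => (hx.1 i).1

/-- The matrix `Z` with columns `√x_i v_i`, so that `∑_i x_i v_i v_iᵀ = Z Zᵀ`. -/
noncomputable def scaledCols (v : Fin n → Fin m → ℝ) (x : Fin n → ℝ) : Matrix (Fin m) (Fin n) ℝ :=
  colMatrix v * diagonal fun i => √(x i)

theorem scaledCols_mul_transpose (v : Fin n → Fin m → ℝ) (hx : 0 ≤ x) :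
    scaledCols v x * (scaledCols v x)ᵀ = wsum v x := by
  ext i j
  rw [wsum, Matrix.sum_apply, Matrix.mul_apply]
  refine sum_congr rfl fun l _ => ?_
  simp only [scaledCols, mul_diagonal, transpose_apply, colMatrix, of_apply, Matrix.smul_apply,
    vecMulVec_apply, smul_eq_mul]
  linear_combination v l i * v l j * Real.mul_self_sqrt (hx l)

theorem posSemidef_wsum (v : Fin n → Fin m → ℝ) (hx : 0 ≤ x) : (wsum v x).PosSemidef := by
  simpa [scaledCols_mul_transpose v hx] using posSemidef_self_mul_conjTranspose (scaledCols v x)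

theorem hasSubgradientsOn_phiReg_wsum (hk : 1 ≤ k) (hkm : k ≤ m) (v : Fin n → Fin m → ℝ)
    {t : Set (Fin n → ℝ)}
    (ht : ∀ x ∈ t, 0 ≤ x ∧ 0 < waterLevel m k (eig (wsum v x)) + lam) :
    HasSubgradientsOn t fun x => phiReg m k lam (eig (wsum v x)) := by
  have hsub : HasSubgradientsOn (wsum v '' t) fun X => phiReg m k lam (eig X) :=
    hasSubgradientsOn_phiReg_eig hk hkm <| Set.forall_mem_image.2 fun x hx =>
      ⟨posSemidef_wsum v (ht x hx).1, (ht x hx).2⟩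
  exact hsub.comp_linearMap (Fintype.linearCombination ℝ fun i => vecMulVec (v i) (v i))
    (Set.mapsTo_image (wsum v) t)

theorem isLeast_sInf_image_feasible {f : (Fin n → ℝ) → ℝ} (hkn : k ≤ n)
    (hf : HasSubgradientsOn (feasible n k) f) :
    IsLeast (f '' feasible n k) (sInf (f '' feasible n k)) :=
  hf.isLeast_sInf_image (isCompact_feasible n k) ⟨_, firstVertex_mem_feasible hkn⟩

section Columns

variable {a : Fin n → Fin d → ℝ}

theorem objC_eq_phiReg (hd : 1 ≤ d) (hlam : 0 < lam) (hx : 0 ≤ x) :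
    objC a lam x = phiReg d d lam (eig (wsum a x)) := by
  have hX := posSemidef_wsum a hx
  rw [objC, trace_inv_add_smul_one hX hlam, phiReg_self hd (isSpectrum_eig hX)]

theorem objN_eq_phiReg (hd : 1 ≤ d) (hk : 1 ≤ k) (hlam : 0 < lam) (hx : 0 ≤ x) :
    objN a lam k x =
      phiReg d (min k d) lam (eig (wsum a x)) + ((d : ℝ) - (min k d : ℕ)) / lam := by
  rw [objN, convGam_eq_phiReg hk hd hlam (posSemidef_wsum a hx)]

theorem hasSubgradientsOn_feasible_phiReg {r : ℕ} (hr : 1 ≤ r) (hrd : r ≤ d) (hlam : 0 < lam) :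
    HasSubgradientsOn (feasible n k) fun x => phiReg d r lam (eig (wsum a x)) :=
  hasSubgradientsOn_phiReg_wsum hr hrd a fun _ hx =>
    have hx := nonneg_of_mem_feasible hx
    ⟨hx, add_pos_of_nonneg_of_pos
      (waterLevel_nonneg hr hrd (isSpectrum_eig (posSemidef_wsum a hx))) hlam⟩

theorem isLeast_objC (hd : 1 ≤ d) (hkn : k ≤ n) (hlam : 0 < lam) :
    IsLeast (objC a lam '' feasible n k) (nuC a lam k) :=
  isLeast_sInf_image_feasible hkn <| (hasSubgradientsOn_feasible_phiReg hd le_rfl hlam).congr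
    fun _ hx => objC_eq_phiReg hd hlam (nonneg_of_mem_feasible hx)

theorem isLeast_objN (hd : 1 ≤ d) (hk : 1 ≤ k) (hkn : k ≤ n) (hlam : 0 < lam) :
    IsLeast (objN a lam k '' feasible n k) (nuN a lam k) :=
  isLeast_sInf_image_feasible hkn <|
    ((hasSubgradientsOn_feasible_phiReg (le_min hk hd) (min_le_right k d) hlam).add_const _).congr
      fun _ hx => objN_eq_phiReg hd hk hlam (nonneg_of_mem_feasible hx)

theorem nuN_eq_nuC (hd : 1 ≤ d) (hdk : d ≤ k) (hlam : 0 < lam) :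
    nuN a lam k = nuC a lam k := by
  refine congrArg sInf (Set.image_congr fun x hx => ?_)
  have hx := nonneg_of_mem_feasible hx
  rw [objN_eq_phiReg hd (hd.trans hdk) hlam hx, objC_eq_phiReg hd hlam hx, min_eq_right hdk,
    sub_self, zero_div, add_zero]

theorem objC_le_objN (hd : 1 ≤ d) (hk : 1 ≤ k) (hlam : 0 < lam) (hx : 0 ≤ x) :
    objC a lam x ≤ objN a lam k x := by
  have hσ := isSpectrum_eig (posSemidef_wsum a hx)
  have hpos := add_pos_of_nonneg_of_pos (waterLevel_nonneg hd le_rfl hσ) hlam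
  have hrd := min_le_right k d
  rw [objC_eq_phiReg hd hlam hx, objN_eq_phiReg hd hk hlam hx]
  exact phiReg_le_phiReg_add hd le_rfl hσ hpos (le_min hk hd) hrd hrd hσ hlam fun w _ => by simp

theorem nuC_le_nuN (hd : 1 ≤ d) (hk : 1 ≤ k) (hkn : k ≤ n) (hlam : 0 < lam) :
    nuC a lam k ≤ nuN a lam k :=
  le_of_isLeast_image (isLeast_objC hd hkn hlam) (isLeast_objN hd hk hkn hlam)
    fun _ hx => objC_le_objN hd hk hlam (nonneg_of_mem_feasible hx)

end Columns

section Factor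

variable {a : Fin n → Fin d → ℝ} {H : Matrix (Fin n) (Fin n) ℝ} {w : ℕ → ℝ}

theorem transpose_scaledCols_mul_of_factor (hH : Hᵀ * H = covMatrix a lam) (hx : 0 ≤ x) :
    (scaledCols (fun i j => H j i) x)ᵀ * scaledCols (fun i j => H j i) x =
      (scaledCols a x)ᵀ * scaledCols a x + lam • diagonal x := by
  let S : Matrix (Fin n) (Fin n) ℝ := diagonal fun i => √(x i)
  have hgram : ∀ {r : ℕ} (v : Fin n → Fin r → ℝ),
      (scaledCols v x)ᵀ * scaledCols v x = S * ((colMatrix v)ᵀ * colMatrix v) * S := fun v => by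
    simp only [scaledCols, S, transpose_mul, diagonal_transpose, Matrix.mul_assoc]
  have hsq : S * S = diagonal x := by
    simp only [S, diagonal_mul_diagonal, Real.mul_self_sqrt (hx _)]
  calc _ = S * (Hᵀ * H) * S := hgram _
    _ = S * ((colMatrix a)ᵀ * colMatrix a) * S + lam • (S * S) := by
        rw [hH, covMatrix, Matrix.mul_add, Matrix.add_mul, Matrix.mul_smul, Matrix.smul_mul,
          Matrix.mul_one]
    _ = _ := by rw [hgram, hsq]

/-- The Gram matrices `Zᵀ Z` turn `Hᵀ H = Aᵀ A + λ I` into a shift of the eigenvalues by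
`λ diag(x)`. -/
theorem sum_mul_eig_wsum_le (hkn : k ≤ n) (hlam : 0 ≤ lam) (hH : Hᵀ * H = covMatrix a lam)
    (hx : x ∈ feasible n k) (hw : Monotone w) :
    ∑ i ∈ range d, w i * eig (wsum a x) i + lam * ∑ i ∈ range k, w i ≤
      ∑ i ∈ range n, w i * eig (wsum (fun i j => H j i) x) i := by
  have hx0 := nonneg_of_mem_feasible hx
  set Z := scaledCols a x with hZ
  have hgram : (Zᵀ * Z).PosSemidef := by simpa using posSemidef_conjTranspose_mul_self Z
  rw [← scaledCols_mul_transpose a hx0, ← scaledCols_mul_transpose _ hx0, ← hZ,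
    ← sum_mul_eig_transpose_mul_self, ← sum_mul_eig_transpose_mul_self,
    transpose_scaledCols_mul_of_factor hH hx0]
  calc _ ≤ ∑ i ∈ range n, w i * eig (Zᵀ * Z) i + lam * ∑ i ∈ range n, w i * eig (diagonal x) i :=
        add_le_add_right
          (mul_le_mul_of_nonneg_left (sum_range_le_sum_mul_eig_diagonal hkn hw hx) hlam) _
    _ ≤ _ := sum_mul_eig_add_smul_le hgram (PosSemidef.diagonal hx0) hlam hw

theorem eig_wsum_factor_pos (hk : 1 ≤ k) (hkn : k ≤ n) (hlam : 0 < lam)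
    (hH : Hᵀ * H = covMatrix a lam) (hx : x ∈ feasible n k) :
    0 < eig (wsum (fun i j => H j i) x) (k - 1) := by
  have hx0 := nonneg_of_mem_feasible hx
  have hβ := isSpectrum_eig (posSemidef_wsum (fun i j => H j i) hx0)
  have hσ := isSpectrum_eig (posSemidef_wsum a hx0)
  set β := eig (wsum (fun i j => H j i) x)
  let w : ℕ → ℝ := fun i => if k - 1 ≤ i then 1 else 0
  have hw0 : ∀ i, 0 ≤ w i := fun i => ite_nonneg zero_le_one le_rfl
  have hw : Monotone w := fun i j hij => by
    by_cases hi : k - 1 ≤ i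
    · simp only [w, hi, hi.trans hij, if_true, le_refl]
    · exact (if_neg hi).trans_le (hw0 j)
  have htop : 1 ≤ ∑ i ∈ range k, w i := (if_pos le_rfl).ge.trans
    (single_le_sum (fun i _ => hw0 i) (mem_range.2 (Nat.sub_one_lt_of_lt hk)))
  have hdom := sum_mul_eig_wsum_le hkn hlam.le hH hx hw
  have hsum : 0 < ∑ i ∈ range n, w i * β i := by
    have hσ_sum := sum_nonneg fun i (_ : i ∈ range d) => mul_nonneg (hw0 i) (hσ.nonneg i)
    linarith [le_mul_of_one_le_right hlam.le htop]
  refine (hβ.nonneg _).lt_of_ne' fun hzero => hsum.ne' (sum_eq_zero fun i _ => ?_)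
  by_cases hi : k - 1 ≤ i
  · rw [((hβ.antitone hi).trans_eq hzero).antisymm (hβ.nonneg i), mul_zero]
  · simp only [w, hi, if_false, zero_mul]

theorem waterLevel_factor_pos (hk : 1 ≤ k) (hkn : k ≤ n) (hlam : 0 < lam)
    (hH : Hᵀ * H = covMatrix a lam) (hx : x ∈ feasible n k) :
    0 < waterLevel n k (eig (wsum (fun i j => H j i) x)) + 0 := by
  rw [add_zero]
  exact waterLevel_pos hk hkn (isSpectrum_eig (posSemidef_wsum _ (nonneg_of_mem_feasible hx)))
    (eig_wsum_factor_pos hk hkn hlam hH hx)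

theorem objM_eq_phiReg (hk : 1 ≤ k) (hkn : k ≤ n) (hx : 0 ≤ x) :
    objM d H lam k x =
      phiReg n k 0 (eig (wsum (fun i j => H j i) x)) + ((d : ℝ) - k) / lam := by
  rw [objM, Phi, phi_eq_phiReg_zero hk hkn (isSpectrum_eig (posSemidef_wsum _ hx))]

theorem isLeast_objM (hk : 1 ≤ k) (hkn : k ≤ n) (hlam : 0 < lam)
    (hH : Hᵀ * H = covMatrix a lam) :
    IsLeast (objM d H lam k '' feasible n k) (nuM d H lam k) :=
  have hsub := hasSubgradientsOn_phiReg_wsum hk hkn (fun i j => H j i) fun _ hx =>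
    ⟨nonneg_of_mem_feasible hx, waterLevel_factor_pos hk hkn hlam hH hx⟩
  isLeast_sInf_image_feasible hkn <| (hsub.add_const _).congr fun _ hx =>
    objM_eq_phiReg hk hkn (nonneg_of_mem_feasible hx)

theorem objM_le_objN (hd : 1 ≤ d) (hk : 1 ≤ k) (hkn : k ≤ n) (hlam : 0 < lam)
    (hH : Hᵀ * H = covMatrix a lam) (hx : x ∈ feasible n k) :
    objM d H lam k x ≤ objN a lam k x := by
  have hx0 := nonneg_of_mem_feasible hx
  have hle := phiReg_le_phiReg_add hk hkn (isSpectrum_eig (posSemidef_wsum _ hx0))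
    (waterLevel_factor_pos hk hkn hlam hH hx) (le_min hk hd) (min_le_right k d)
    (min_le_left k d) (isSpectrum_eig (posSemidef_wsum a hx0)) hlam fun w hw => by
      simpa using sum_mul_eig_wsum_le hkn hlam.le hH hx hw
  rw [objM_eq_phiReg hk hkn hx0, objN_eq_phiReg hd hk hlam hx0]
  linear_combination hle

theorem nuM_le_nuN (hd : 1 ≤ d) (hk : 1 ≤ k) (hkn : k ≤ n) (hlam : 0 < lam)
    (hH : Hᵀ * H = covMatrix a lam) : nuM d H lam k ≤ nuN a lam k :=
  le_of_isLeast_image (isLeast_objM hk hkn hlam hH) (isLeast_objN hd hk hkn hlam)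
    fun _ hx => objM_le_objN hd hk hkn hlam hH hx

end Factor

end Relaxations

end RAOD

theorem theorem4_general (d n k : ℕ) (hd : 1 ≤ d) (hk : 1 ≤ k) (hkn : k ≤ n)
    (lam : ℝ) (hlam : 0 < lam) (a : Fin n → Fin d → ℝ) :
    IsLeast (RAOD.objC a lam '' RAOD.feasible n k) (RAOD.nuC a lam k) ∧
    IsLeast (RAOD.objN a lam k '' RAOD.feasible n k) (RAOD.nuN a lam k) ∧
    (d ≤ k → RAOD.nuN a lam k = RAOD.nuC a lam k) ∧
    RAOD.nuC a lam k ≤ RAOD.nuN a lam k ∧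
    (∀ H : Matrix (Fin n) (Fin n) ℝ, H.transpose * H = RAOD.covMatrix a lam →
      IsLeast (RAOD.objM d H lam k '' RAOD.feasible n k) (RAOD.nuM d H lam k) ∧
      RAOD.nuM d H lam k ≤ RAOD.nuN a lam k) :=
  ⟨RAOD.isLeast_objC hd hkn hlam, RAOD.isLeast_objN hd hk hkn hlam,
    fun hdk => RAOD.nuN_eq_nuC hd hdk hlam, RAOD.nuC_le_nuN hd hk hkn hlam, fun _ hH =>
      ⟨RAOD.isLeast_objM hk hkn hlam hH, RAOD.nuM_le_nuN hd hk hkn hlam hH⟩⟩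

theorem theorem4 (d n k : ℕ) (hd : 1 ≤ d) (hdn : d ≤ n) (hk : 1 ≤ k) (hkn : k ≤ n)
    (lam : ℝ) (hlam : 0 < lam) (a : Fin n → Fin d → ℝ) :
    -- the minima that define the first two values are attained
    IsLeast (RAOD.objC a lam '' RAOD.feasible n k) (RAOD.nuC a lam k) ∧
    IsLeast (RAOD.objN a lam k '' RAOD.feasible n k) (RAOD.nuN a lam k) ∧
    -- (i)
    (d ≤ k → RAOD.nuN a lam k = RAOD.nuC a lam k) ∧
    -- (ii)
    (k < d → RAOD.nuC a lam k ≤ RAOD.nuN a lam k) ∧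
    -- (iii), with attainment, for every factorization `C = Hᵀ H`
    (∀ H : Matrix (Fin n) (Fin n) ℝ, H.transpose * H = RAOD.covMatrix a lam →
      IsLeast (RAOD.objM d H lam k '' RAOD.feasible n k) (RAOD.nuM d H lam k) ∧
      RAOD.nuM d H lam k ≤ RAOD.nuN a lam k) := by
  obtain ⟨hC, hN, hi, hii, hiii⟩ := theorem4_general d n k hd hk hkn lam hlam a
  exact ⟨hC, hN, hi, fun _ => hii, hiii⟩
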